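/- Let $X$ be a complex Banach space whose dual $X^*$ has the bounded approximation property: there is a constant $C$ such that for every compact set $K\subset X^*$ and every $\varepsilon>0$ there is a continuous finite rank operator $T$ on $X^*$ with $\|T\|\le C$ and $\|Tf-f\|\le\varepsilon$ for all $f\in K$. Let $\mathcal A(X)$ be the algebra of approximable operators on $X$, that is, the closure in the operator norm of the algebra of continuous finite rank operators $X\to X$. Let $B$ be a (not necessarily unital) complex Banach algebra having a bounded approximate identity, i.e. a bounded net $(e_\lambda)$ in $B$ with $be_\lambda\to b$ and $e_\lambda b\to b$ for every $b\in B$. Write $a\circ b=ab+ba$ for the Jordan product. Let $\Phi\colon\mathcal A(X)\to B$ be a surjective continuous linear map such that for all $S,T\in\mathcal A(X)$, $$ST=TS=0\ \Longrightarrow\ \Phi(S)\circ\Phi(T)=0.$$ Then $\Phi$ is a weighted Jordan homomorphism: there exist a bijective linear map $W\colon B\to B$ with $W(ab)=W(a)b=aW(b)$ for all $a,b\in B$ (an invertible centralizer of $B$) and a linear map $\Psi\colon\mathcal A(X)\to B$ with $\Psi(S\circ T)=\Psi(S)\circ\Psi(T)$ for all $S,T\in\mathcal A(X)$ (a Jordan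 homomorphism) such that $\Phi=W\Psi$. -/

import Mathlib

open Filter

/-- A continuous linear operator has finite rank if its range is finite-dimensional. -/
def HasFiniteRank {X : Type*} [NormedAddCommGroup X] [NormedSpace ℂ X] (T : X →L[ℂ] X) : Prop :=
  FiniteDimensional ℂ (LinearMap.range (T : X →ₗ[ℂ] X))

/-- The algebra of continuous finite rank operators on `X`, with composition as product. -/
def finiteRankOperators (X : Type*) [NormedAddCommGroup X] [NormedSpace ℂ X] :
    NonUnitalSubalgebra ℂ (X →L[ℂ] X) where
  carrier := {T | HasFiniteRank T}
  add_mem' := by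
    intro S T hS hT
    have : FiniteDimensional ℂ (LinearMap.range (S : X →ₗ[ℂ] X)) := hS
    have : FiniteDimensional ℂ (LinearMap.range (T : X →ₗ[ℂ] X)) := hT
    exact Submodule.finiteDimensional_of_le
      (LinearMap.range_add_le (S : X →ₗ[ℂ] X) (T : X →ₗ[ℂ] X))
  zero_mem' := by
    change FiniteDimensional ℂ (LinearMap.range (0 : X →ₗ[ℂ] X))
    rw [LinearMap.range_zero]
    infer_instance
  mul_mem' := by
    intro S T hS _
    have : FiniteDimensional ℂ (LinearMap.range (S : X →ₗ[ℂ] X)) := hS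
    exact Submodule.finiteDimensional_of_le
      (LinearMap.range_comp_le_range (T : X →ₗ[ℂ] X) (S : X →ₗ[ℂ] X))
  smul_mem' := by
    intro c T hT
    have : FiniteDimensional ℂ (LinearMap.range (T : X →ₗ[ℂ] X)) := hT
    refine Submodule.finiteDimensional_of_le (S₂ := LinearMap.range (T : X →ₗ[ℂ] X)) ?_
    rintro _ ⟨x, rfl⟩
    exact ⟨c • x, map_smul T c x⟩

/-- The algebra of approximable operators on `X`: the closure, in the operator norm, of the algebra
of continuous finite rank operators. -/
noncomputable def approximableOperators (X : Type*) [NormedAddCommGroup X] [NormedSpace ℂ X] :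
    NonUnitalSubalgebra ℂ (X →L[ℂ] X) :=
  (finiteRankOperators X).topologicalClosure

/-- The bounded approximation property: for some constant `C`, the identity can be approximated
uniformly on compact sets by continuous finite rank operators of norm at most `C`. -/
def BoundedApproximationProperty (Y : Type*) [NormedAddCommGroup Y] [NormedSpace ℂ Y] : Prop :=
  ∃ C : ℝ, ∀ K : Set Y, IsCompact K → ∀ ε : ℝ, 0 < ε →
    ∃ T : Y →L[ℂ] Y, HasFiniteRank T ∧ ‖T‖ ≤ C ∧ ∀ y ∈ K, ‖T y - y‖ ≤ ε

/-- The existence of a (two-sided) bounded approximate identity. The bounded net `(e_λ)` is given by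
the filter of its tails; conversely a filter as below yields such a net. -/
def HasBoundedApproximateIdentity (B : Type*) [NonUnitalNormedRing B] : Prop :=
  ∃ l : Filter B, l.IsApproximateUnit ∧ ∃ M : ℝ, ∀ᶠ e in l, ‖e‖ ≤ M

/-- The Jordan product `a ∘ b = ab + ba`. -/
def jordanProduct {R : Type*} [NonUnitalRing R] (a b : R) : R :=
  a * b + b * a

/-- A linear map `W` with `W (ab) = W(a) b = a W(b)` for all `a`, `b`. -/
def IsCentralizer {B : Type*} [NonUnitalRing B] [Module ℂ B] (W : B →ₗ[ℂ] B) : Prop :=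
  ∀ a b : B, W (a * b) = W a * b ∧ W (a * b) = a * W b

/-- A linear map preserving the Jordan product. -/
def IsJordanHomomorphism {A B : Type*} [NonUnitalRing A] [Module ℂ A] [NonUnitalRing B] [Module ℂ B]
    (Ψ : A →ₗ[ℂ] B) : Prop :=
  ∀ a b : A, Ψ (jordanProduct a b) = jordanProduct (Ψ a) (Ψ b)

/-- A linear map of the form `W ∘ Ψ` with `W` an invertible centralizer of `B` and `Ψ` a Jordan
homomorphism from `A` to `B`. -/
def IsWeightedJordanHomomorphism {A B : Type*} [NonUnitalRing A] [Module ℂ A] [NonUnitalRing B]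
    [Module ℂ B] (Φ : A →ₗ[ℂ] B) : Prop :=
  ∃ W : B →ₗ[ℂ] B, IsCentralizer W ∧ Function.Bijective W ∧
    ∃ Ψ : A →ₗ[ℂ] B, IsJordanHomomorphism Ψ ∧ Φ = W ∘ₗ Ψ

/-! Write `F` for the finite rank operators, `A` for their closure, and `φ(S, T) = Φ(S) ∘ Φ(T)`.

Algebra: `F` is spanned by idempotents and has local units. Comparing the Peirce components of `s`
relative to an idempotent `p` gives `2 φ(s, p) = φ(s ∘ p, e)` for every local unit `e`. Hence `φ(S,
T) = τ(S ∘ T)` on `F`, where `τ(a) = ½ φ(a, e)` (`exists_factor_jordanProduct`).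

Boundedness: `τ` is not visibly bounded, because the norms of local units are not controlled. The
approximation property of `X*` supplies a bounded net `E i` in `F` whose adjoints tend strongly to
the identity (`exists_finiteRank_net`). Along it `Φ(S) ∘ Φ(E i) = τ(S ∘ E i)` tends weakly to `2
τ(S)` (`tendsto_apply_jordanProduct`). So `τ` is bounded and extends to `A`, with the same identity
and the same weak limit.

The weight: the weak limit shows that `Φ S = 0` forces `τ S = 0`, so `τ = L Φ` with `L` bounded on
`B`. The elements `Φ(E i)` commute with `B` asymptotically in the weak sense, so `Φ(E i) z` and `z
Φ(E i)` both tend weakly to `L z`, and `L` is a centralizer. The approximate identity of `B` makes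
`L` bijective, and then `Φ = L (L⁻¹ Φ)` with `L⁻¹ Φ` a Jordan homomorphism
(`isWeightedJordanHomomorphism_of_factor`). -/

/-! ### Zero product preserving bilinear maps and Peirce decompositions -/

section ZeroProduct

variable {F B : Type*} [NonUnitalRing F] [Module ℂ F] [AddCommGroup B] [Module ℂ B]

/-- On an off-diagonal Peirce component, `φ (·, e) = 2 φ (·, p)`. -/
theorem apply_localUnit_of_offDiagonal (φ : F →ₗ[ℂ] F →ₗ[ℂ] B) (hs : ∀ a b, φ a b = φ b a)
    (hφ : ∀ a b, a * b = 0 → b * a = 0 → φ a b = 0) {p e n : F} (hp : p * p = p)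
    (hep : e * p = p) (hpe : p * e = p) (hen : e * n = n) (hne : n * e = n) (hnn : n * n = 0)
    (hn : n = p * n + n * p) : φ n e = (2 : ℂ) • φ n p := by
  have h1 : φ p (e - p) = 0 := hφ _ _ (by rw [mul_sub, hpe, hp, sub_self])
    (by rw [sub_mul, hep, hp, sub_self])
  have h2 : φ n n = 0 := hφ _ _ hnn hnn
  -- Since `n² = 0` and `pn + np = n`, the element `p + n` is again an idempotent with unit `e`.
  have h3 : φ (p + n) (e - (p + n)) = 0 := by
    apply hφ
    · rw [mul_sub, add_mul, hpe, hne, mul_add, add_mul, add_mul, hp, hnn]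
      nth_rw 1 [hn]
      abel
    · rw [sub_mul, mul_add, hep, hen, mul_add, add_mul, add_mul, hp, hnn]
      nth_rw 1 [hn]
      abel
  rw [← sub_sub, map_sub, map_add, LinearMap.add_apply, LinearMap.add_apply, h1, h2, map_sub,
    hs p n] at h3
  rw [two_smul, ← sub_eq_zero, ← h3]
  abel

/-- In the Peirce decomposition, `s ∘ p = 2 s₁₁ + s₁₀ + s₀₁`. Pairing with `e` instead of `p` leaves
the `11` part unchanged and doubles the off-diagonal parts, while `s₀₀` pairs to zero with `p`. -/
theorem two_smul_apply_idempotent (φ : F →ₗ[ℂ] F →ₗ[ℂ] B) (hs : ∀ a b, φ a b = φ b a)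
    (hφ : ∀ a b, a * b = 0 → b * a = 0 → φ a b = 0) {p e s : F} (hp : p * p = p)
    (hep : e * p = p) (hpe : p * e = p) (hes : e * s = s) (hse : s * e = s) :
    (2 : ℂ) • φ s p = φ (jordanProduct s p) e := by
  have hp' : ∀ x, p * (p * x) = p * x := fun x => by rw [← mul_assoc, hp]
  have hep' : ∀ x, e * (p * x) = p * x := fun x => by rw [← mul_assoc, hep]
  have hes' : ∀ x, e * (s * x) = s * x := fun x => by rw [← mul_assoc, hes]
  have h11 : φ (p * s * p) (e - p) = 0 := by
    apply hφ
    · simp only [mul_sub, mul_assoc, hpe, hp, sub_self]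
    · simp only [sub_mul, mul_assoc, hep', hp', sub_self]
  have h00 : φ (s - p * s - s * p + p * s * p) p = 0 := by
    apply hφ
    · simp only [add_mul, sub_mul, mul_assoc, hp]; abel
    · simp only [mul_add, mul_sub, mul_assoc, hp']; abel
  have h10 : φ (p * s - p * s * p) e = (2 : ℂ) • φ (p * s - p * s * p) p := by
    apply apply_localUnit_of_offDiagonal φ hs hφ hp hep hpe
    · simp only [mul_sub, mul_assoc, hep']
    · simp only [sub_mul, mul_assoc, hse, hpe]
    · simp only [mul_sub, sub_mul, mul_assoc, hp']; abel
    · simp only [mul_sub, sub_mul, mul_assoc, hp', hp]; abel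
  have h01 : φ (s * p - p * s * p) e = (2 : ℂ) • φ (s * p - p * s * p) p := by
    apply apply_localUnit_of_offDiagonal φ hs hφ hp hep hpe
    · simp only [mul_sub, mul_assoc, hes', hep']
    · simp only [sub_mul, mul_assoc, hpe]
    · simp only [mul_sub, sub_mul, mul_assoc, hp']; abel
    · simp only [mul_sub, sub_mul, mul_assoc, hp', hp]; abel
  simp only [jordanProduct, map_add, map_sub, LinearMap.add_apply, LinearMap.sub_apply, smul_sub]
    at *
  rw [sub_eq_zero] at h11
  have e1 : φ (p * s) e = (2 : ℂ) • φ (p * s) p - (2 : ℂ) • φ (p * s * p) p + φ (p * s * p) p := by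
    rw [← h10, h11]; abel
  have e2 : φ (s * p) e = (2 : ℂ) • φ (s * p) p - (2 : ℂ) • φ (p * s * p) p + φ (p * s * p) p := by
    rw [← h01, h11]; abel
  have e3 : φ s p = φ (p * s) p + φ (s * p) p - φ (p * s * p) p := by
    rw [← sub_eq_zero, ← h00]; abel
  rw [e1, e2, e3]
  module

/-- In an algebra with local units which is spanned by idempotents, a symmetric bilinear map
vanishing on pairs with two-sided zero product factors through the Jordan product. -/
theorem exists_factor_jordanProduct (φ : F →ₗ[ℂ] F →ₗ[ℂ] B) (hs : ∀ a b, φ a b = φ b a)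
    (hφ : ∀ a b, a * b = 0 → b * a = 0 → φ a b = 0) [IsScalarTower ℂ F F] [SMulCommClass ℂ F F]
    (hu : ∀ a b : F, ∃ e : F, (e * a = a ∧ a * e = a) ∧ e * b = b ∧ b * e = b)
    (hspan : ⊤ ≤ Submodule.span ℂ {p : F | p * p = p}) :
    ∃ τ : F →ₗ[ℂ] B, ∀ a b, φ a b = τ (jordanProduct a b) := by
  have hwd : ∀ a e e' : F, e * a = a ∧ a * e = a → e' * a = a ∧ a * e' = a → φ a e = φ a e' := by
    intro a e e' h h'
    rw [← sub_eq_zero, ← map_sub]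
    exact hφ _ _ (by rw [mul_sub, h.2, h'.2, sub_self]) (by rw [sub_mul, h.1, h'.1, sub_self])
  choose e he he' using hu
  -- The factor is forced by `a ∘ e = 2a`. By `hwd` any local unit gives the same value, so a common
  -- one for two elements yields additivity.
  let τ : F →ₗ[ℂ] B :=
    { toFun := fun a => (2⁻¹ : ℂ) • φ a (e a a)
      map_add' := by
        intro a b
        have h1 := he a b
        have h2 := he' a b
        rw [hwd a _ _ (he a a) h1, hwd b _ _ (he b b) h2,
          hwd (a + b) _ (e a b) (he _ _)
            ⟨by rw [mul_add, h1.1, h2.1], by rw [add_mul, h1.2, h2.2]⟩, map_add,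
          LinearMap.add_apply, smul_add]
      map_smul' := by
        intro c a
        have h1 := he a a
        rw [hwd (c • a) _ (e a a) (he _ _)
            ⟨by rw [mul_smul_comm, h1.1], by rw [smul_mul_assoc, h1.2]⟩, map_smul,
          LinearMap.smul_apply, smul_comm]
        rfl }
  refine ⟨τ, fun a b => ?_⟩
  have hb : b ∈ Submodule.span ℂ {p : F | p * p = p} := hspan trivial
  induction hb using Submodule.span_induction with
  | mem p hp =>
    have h1 := he a p
    have h2 := he' a p
    have h3 := two_smul_apply_idempotent φ hs hφ hp h2.1 h2.2 h1.1 h1.2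
    have h4 : φ (jordanProduct a p) (e (jordanProduct a p) (jordanProduct a p))
        = φ (jordanProduct a p) (e a p) := by
      refine hwd _ _ _ (he _ _) ⟨?_, ?_⟩
      · rw [jordanProduct, mul_add, ← mul_assoc, ← mul_assoc, h1.1, h2.1]
      · rw [jordanProduct, add_mul, mul_assoc, mul_assoc, h1.2, h2.2]
    change _ = (2⁻¹ : ℂ) • φ (jordanProduct a p) (e (jordanProduct a p) (jordanProduct a p))
    rw [h4, ← h3, smul_smul]
    norm_num
  | zero => simp [jordanProduct]
  | add x y _ _ hx hy =>
    rw [map_add, hx, hy, ← map_add]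
    congr 1
    simp only [jordanProduct, mul_add, add_mul]
    abel
  | smul c x _ hx =>
    rw [map_smul, hx, ← map_smul]
    congr 1
    simp only [jordanProduct, smul_add, mul_smul_comm, smul_mul_assoc]

end ZeroProduct

/-! ### Finite rank operators: idempotents and local units -/

section FiniteRank

variable {X : Type*} [NormedAddCommGroup X] [NormedSpace ℂ X]

/-- The operator `y ↦ f y • x`. -/
noncomputable def rankOne (f : StrongDual ℂ X) (x : X) : finiteRankOperators X :=
  ⟨f.smulRight x, Submodule.finiteDimensional_of_le (S₂ := Submodule.span ℂ {x}) (by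
    rintro _ ⟨y, rfl⟩
    exact Submodule.smul_mem _ _ (Submodule.mem_span_singleton_self x))⟩

@[simp]
theorem coe_rankOne (f : StrongDual ℂ X) (x : X) :
    (rankOne f x : X →L[ℂ] X) = f.smulRight x := rfl

theorem rankOne_mul_rankOne (f g : StrongDual ℂ X) (x y : X) :
    rankOne f x * rankOne g y = f y • rankOne g x := by
  ext z
  simp [smul_smul, mul_comm]

theorem rankOne_add_right (f : StrongDual ℂ X) (x y : X) :
    rankOne f (x + y) = rankOne f x + rankOne f y := by
  ext z; simp

theorem rankOne_smul_right (f : StrongDual ℂ X) (c : ℂ) (x : X) :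
    rankOne f (c • x) = c • rankOne f x := by
  ext z; simp [smul_smul, mul_comm]

theorem mul_rankOne (S : finiteRankOperators X) (f : StrongDual ℂ X) (x : X) :
    S * rankOne f x = rankOne f ((S : X →L[ℂ] X) x) := by
  ext z; simp

theorem rankOne_mul (S : finiteRankOperators X) (f : StrongDual ℂ X) (x : X) :
    rankOne f x * S = rankOne (f.comp (S : X →L[ℂ] X)) x := by
  ext z; simp

/-- A finite rank operator is a sum of rank one operators. -/
theorem mem_span_rankOne (S : finiteRankOperators X) :
    S ∈ Submodule.span ℂ {T | ∃ f x, T = rankOne (X := X) f x} := by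
  have hS : FiniteDimensional ℂ (LinearMap.range ((S : X →L[ℂ] X) : X →ₗ[ℂ] X)) := S.2
  let b := Module.finBasis ℂ (LinearMap.range ((S : X →L[ℂ] X) : X →ₗ[ℂ] X))
  let R : X →L[ℂ] LinearMap.range ((S : X →L[ℂ] X) : X →ₗ[ℂ] X) :=
    (S : X →L[ℂ] X).codRestrict _ (fun x => ⟨x, rfl⟩)
  have h : S = ∑ i, rankOne ((LinearMap.toContinuousLinearMap (b.coord i)).comp R) (b i : X) := by
    ext z
    have h1 := congrArg Subtype.val (b.sum_repr (R z))
    rw [AddSubmonoidClass.coe_finsetSum] at h1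
    rw [AddSubmonoidClass.coe_finsetSum, sum_apply]
    exact h1.symm
  rw [h]
  exact Submodule.sum_mem _ fun i _ => Submodule.subset_span ⟨_, _, rfl⟩

theorem rankOne_mul_self {f : StrongDual ℂ X} {x : X} (h : f x = 1) :
    rankOne f x * rankOne f x = rankOne f x := by
  rw [rankOne_mul_rankOne, h, one_smul]

/-- A rank one operator `f ⊗ x` with `f x ≠ 0` is a multiple of an idempotent. If `f x = 0` and `f z
= 1`, it is the difference of the idempotents `f ⊗ (x + z)` and `f ⊗ z`. -/
theorem span_idempotents_finiteRankOperators :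
    ⊤ ≤ Submodule.span ℂ {p : finiteRankOperators X | p * p = p} := by
  rintro S -
  refine Submodule.span_le.2 ?_ (mem_span_rankOne S)
  rintro _ ⟨f, x, rfl⟩
  by_cases hf : f = 0
  · subst hf
    have : rankOne (0 : StrongDual ℂ X) x = 0 := by ext; simp
    rw [this]
    exact Submodule.zero_mem _
  obtain ⟨z, hz⟩ : ∃ z, f z = 1 := by
    obtain ⟨y, hy⟩ := DFunLike.ne_iff.1 hf
    exact ⟨(f y)⁻¹ • y, by simpa using inv_mul_cancel₀ hy⟩
  have key : ∀ y, f y = 1 → rankOne f y ∈ Submodule.span ℂ {p : finiteRankOperators X | p * p = p} :=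
    fun y hy => Submodule.subset_span (rankOne_mul_self hy)
  by_cases hx : f x = 0
  · have : rankOne f x = rankOne f (x + z) - rankOne f z := by
      rw [rankOne_add_right, add_sub_cancel_right]
    rw [this]
    exact Submodule.sub_mem _ (key _ (by simp [hx, hz])) (key _ hz)
  · have : rankOne f x = f x • rankOne f ((f x)⁻¹ • x) := by
      rw [rankOne_smul_right, smul_smul, mul_inv_cancel₀ hx, one_smul]
    rw [this]
    exact Submodule.smul_mem _ _ (key _ (by simp [hx]))

theorem exists_left_unit (S : finiteRankOperators X) : ∃ P : finiteRankOperators X, P * S = S := by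
  have hS : FiniteDimensional ℂ (LinearMap.range ((S : X →L[ℂ] X) : X →ₗ[ℂ] X)) := S.2
  obtain ⟨p, hp⟩ := Submodule.ClosedComplemented.of_finiteDimensional
    (LinearMap.range ((S : X →L[ℂ] X) : X →ₗ[ℂ] X))
  refine ⟨⟨(Submodule.subtypeL _).comp p, Submodule.finiteDimensional_of_le
    (S₂ := LinearMap.range ((S : X →L[ℂ] X) : X →ₗ[ℂ] X)) ?_⟩, ?_⟩
  · rintro _ ⟨x, rfl⟩
    exact (p x).2
  · ext x
    exact congrArg Subtype.val (hp ⟨(S : X →L[ℂ] X) x, x, rfl⟩)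

/-- Take `Q = g S` with `g` a linear section of `S` over its finite-dimensional range. -/
theorem exists_right_unit (S : finiteRankOperators X) : ∃ Q : finiteRankOperators X, S * Q = S := by
  have hS : FiniteDimensional ℂ (LinearMap.range ((S : X →L[ℂ] X) : X →ₗ[ℂ] X)) := S.2
  obtain ⟨g, hg⟩ := LinearMap.exists_rightInverse_of_surjective
    ((S : X →L[ℂ] X) : X →ₗ[ℂ] X).rangeRestrict (LinearMap.range_rangeRestrict _)
  let R : X →L[ℂ] LinearMap.range ((S : X →L[ℂ] X) : X →ₗ[ℂ] X) :=
    (S : X →L[ℂ] X).codRestrict _ (fun x => ⟨x, rfl⟩)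
  refine ⟨⟨(LinearMap.toContinuousLinearMap g).comp R, Submodule.finiteDimensional_of_le
    (S₂ := LinearMap.range g) ?_⟩, ?_⟩
  · rintro _ ⟨x, rfl⟩
    exact ⟨R x, rfl⟩
  · ext x
    exact congrArg Subtype.val (LinearMap.congr_fun hg (R x))

/-- One-sided units are combined through `1 - (1 - a)(1 - b)`: first two left units, chosen so that
the second repairs the defect `T - PT`, likewise on the right, and finally a left with a right unit.
-/
theorem exists_local_unit (S T : finiteRankOperators X) :
    ∃ e : finiteRankOperators X, (e * S = S ∧ S * e = S) ∧ e * T = T ∧ T * e = T := by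
  obtain ⟨P, hP⟩ := exists_left_unit S
  obtain ⟨P', hP'⟩ := exists_left_unit (T - P * T)
  obtain ⟨Q, hQ⟩ := exists_right_unit S
  obtain ⟨Q', hQ'⟩ := exists_right_unit (T - T * Q)
  obtain ⟨p, hpS, hpT⟩ : ∃ p, p * S = S ∧ p * T = T := by
    refine ⟨P' + P - P' * P, ?_, ?_⟩
    · rw [sub_mul, add_mul, mul_assoc, hP, add_sub_cancel_left]
    · rw [mul_sub] at hP'
      rw [sub_mul, add_mul, mul_assoc, add_sub_right_comm, hP', sub_add_cancel]
  obtain ⟨q, hqS, hqT⟩ : ∃ q, S * q = S ∧ T * q = T := by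
    refine ⟨Q' + Q - Q * Q', ?_, ?_⟩
    · rw [mul_sub, mul_add, ← mul_assoc, hQ, add_sub_cancel_left]
    · rw [sub_mul] at hQ'
      rw [mul_sub, mul_add, ← mul_assoc, add_sub_right_comm, hQ', sub_add_cancel]
  refine ⟨p + q - q * p, ⟨?_, ?_⟩, ?_, ?_⟩
  · rw [sub_mul, add_mul, mul_assoc, hpS, add_sub_cancel_right]
  · rw [mul_sub, mul_add, ← mul_assoc, hqS, add_sub_cancel_left]
  · rw [sub_mul, add_mul, mul_assoc, hpT, add_sub_cancel_right]
  · rw [mul_sub, mul_add, ← mul_assoc, hqT, add_sub_cancel_left]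

end FiniteRank

/-! ### From the approximation property of the dual to a net on the space -/

section Approximation

variable {X : Type*} [NormedAddCommGroup X] [NormedSpace ℂ X]

theorem exists_norm_le_one_lt_re {f : StrongDual ℂ X} {r : ℝ} (hr : r < ‖f‖) :
    ∃ x, ‖x‖ ≤ 1 ∧ r < (f x).re := by
  obtain ⟨y, hy, hry⟩ := f.exists_lt_apply_of_lt_opNorm hr
  refine ⟨((starRingEnd ℂ) (f y) / ‖f y‖) • y, ?_, ?_⟩
  · rw [norm_smul, norm_div, RCLike.norm_conj, Complex.norm_real, norm_norm]
    exact mul_le_one₀ (div_self_le_one _) (norm_nonneg _) hy.le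
  · rw [map_smul, smul_eq_mul, div_mul_eq_mul_div, Complex.conj_mul', ← Complex.ofReal_pow,
      ← Complex.ofReal_div, Complex.ofReal_re, sq, mul_self_div_self]
    exact hry

/-- The dual norm of a functional on a finite `ℓ^∞`-sum dominates the `ℓ^1`-norm of its
components. -/
theorem sum_norm_comp_single_le {κ : Type*} [Fintype κ] [DecidableEq κ]
    (H : StrongDual ℂ (κ → X)) :
    ∑ k, ‖H.comp (ContinuousLinearMap.single ℂ (fun _ : κ => X) k)‖ ≤ ‖H‖ := by
  refine le_of_forall_pos_le_add fun ε hε => ?_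
  have hδ : 0 < ε / (Fintype.card κ + 1) := by positivity
  choose y hy hy' using fun k => exists_norm_le_one_lt_re (sub_lt_self
    ‖H.comp (ContinuousLinearMap.single ℂ (fun _ : κ => X) k)‖ hδ)
  have h1 : H y = ∑ k, H.comp (ContinuousLinearMap.single ℂ (fun _ : κ => X) k) (y k) := by
    conv_lhs => rw [← Finset.univ_sum_single y]
    rw [map_sum]
    rfl
  have h2 : (H y).re ≤ ‖H‖ := (Complex.re_le_norm _).trans
    ((H.le_opNorm y).trans (mul_le_of_le_one_right (norm_nonneg _)
      ((pi_norm_le_iff_of_nonneg zero_le_one).2 hy)))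
  have h3 := Finset.sum_le_sum fun k (_ : k ∈ Finset.univ) => (hy' k).le
  rw [← Complex.re_sum, ← h1, Finset.sum_sub_distrib, Finset.sum_const, Finset.card_univ,
    nsmul_eq_mul] at h3
  have h4 : (Fintype.card κ : ℝ) * (ε / (Fintype.card κ + 1)) ≤ ε := by
    rw [mul_div_assoc', div_le_iff₀ (by positivity)]
    nlinarith
  linarith

/-- A finite-dimensional space of functionals is normed, up to a factor `2`, by finitely many
vectors of the unit ball. -/
theorem exists_norming_finset {Y : Type*} [NormedAddCommGroup Y] [NormedSpace ℂ Y]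
    [FiniteDimensional ℂ Y] (j : Y →ₗ[ℂ] StrongDual ℂ X) (hj : ∀ v, ‖j v‖ = ‖v‖) :
    ∃ s : Finset X, (∀ x ∈ s, ‖x‖ ≤ 1) ∧
      ∀ v : Y, ∀ c : ℝ, 0 ≤ c → (∀ x ∈ s, ‖j v x‖ ≤ c) → ‖v‖ ≤ 2 * c := by
  classical
  have : ProperSpace Y := FiniteDimensional.proper ℂ Y
  -- A `1/4`-net of the sphere, each point tested above `3/4`, tests every unit vector above `1/2`;
  -- hence the factor `2`.
  obtain ⟨t, hts, htf, ht⟩ := finite_cover_balls_of_compact (isCompact_sphere (0 : Y) 1)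
    (show (0 : ℝ) < 1 / 4 by norm_num)
  have hx : ∀ v : Y, ∃ x, ‖x‖ ≤ 1 ∧ (v ∈ t → 3 / 4 < (j v x).re) := by
    intro v
    by_cases hv : v ∈ t
    · have h1 : ‖j v‖ = 1 := by rw [hj]; simpa using hts hv
      obtain ⟨x, hx, hx'⟩ := exists_norm_le_one_lt_re
        (show 3 / 4 < ‖j v‖ by rw [h1]; norm_num)
      exact ⟨x, hx, fun _ => hx'⟩
    · exact ⟨0, by simp, fun h => absurd h hv⟩
  choose x hx1 hx2 using hx
  refine ⟨htf.toFinset.image x, ?_, ?_⟩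
  · intro y hy
    obtain ⟨v, -, rfl⟩ := Finset.mem_image.1 hy
    exact hx1 v
  intro v c hc hvc
  by_cases h0 : v = 0
  · simpa [h0] using hc
  have hn : 0 < ‖v‖ := norm_pos_iff.2 h0
  let w : Y := ((‖v‖ : ℂ)⁻¹) • v
  have hw : w ∈ Metric.sphere (0 : Y) 1 := by
    rw [mem_sphere_zero_iff_norm, norm_smul, norm_inv, Complex.norm_real, norm_norm]
    exact inv_mul_cancel₀ hn.ne'
  obtain ⟨u, hu, huw⟩ := Set.mem_iUnion₂.1 (ht hw)
  have h1 : ‖j (w - u) (x u)‖ ≤ 1 / 4 := by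
    refine (ContinuousLinearMap.le_opNorm _ _).trans ?_
    rw [Metric.mem_ball, dist_eq_norm] at huw
    rw [hj]
    nlinarith [hx1 u, norm_nonneg (x u), norm_nonneg (w - u)]
  have h2 : 3 / 4 < ‖j u (x u)‖ := (hx2 u hu).trans_le (Complex.re_le_norm _)
  have h3 : ‖j w (x u)‖ = ‖v‖⁻¹ * ‖j v (x u)‖ := by
    rw [map_smul, smul_apply, norm_smul, norm_inv, Complex.norm_real, norm_norm]
  have h4 := norm_sub_norm_le (j u (x u)) (j w (x u))
  rw [map_sub, sub_apply] at h1
  rw [norm_sub_rev] at h4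
  have h6 : 1 / 2 < ‖v‖⁻¹ * ‖j v (x u)‖ := by rw [← h3]; linarith
  have h7 := hvc (x u) (Finset.mem_image_of_mem x (htf.mem_toFinset.2 hu))
  rw [inv_mul_eq_div, lt_div_iff₀ hn] at h6
  linarith

/-- A finite rank operator on `X*` lies in the weak closure of a bounded set of adjoints of finite
rank operators on `X`. -/
theorem exists_finiteRank_comp_near {T : StrongDual ℂ X →L[ℂ] StrongDual ℂ X}
    (hT : HasFiniteRank T) {C : ℝ} (hC : 0 < C) (hTC : ‖T‖ ≤ C) {ι : Type*} [Fintype ι]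
    (g : ι → StrongDual ℂ X) {ε : ℝ} (hε : 0 < ε) :
    ∃ E : finiteRankOperators X, ‖(E : X →L[ℂ] X)‖ ≤ 2 * C ∧
      ∀ j, ‖(g j).comp (E : X →L[ℂ] X) - T (g j)‖ ≤ ε := by
  classical
  have hV : FiniteDimensional ℂ (LinearMap.range (T : StrongDual ℂ X →ₗ[ℂ] StrongDual ℂ X)) := hT
  set V := LinearMap.range (T : StrongDual ℂ X →ₗ[ℂ] StrongDual ℂ X) with hVdef
  have hTV : ∀ f, T f ∈ V := fun f => ⟨f, rfl⟩
  obtain ⟨s, hs1, hs2⟩ : ∃ s : Finset X, (∀ x ∈ s, ‖x‖ ≤ 1) ∧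
      ∀ v ∈ V, ∀ c : ℝ, 0 ≤ c → (∀ x ∈ s, ‖v x‖ ≤ c) → ‖v‖ ≤ 2 * c := by
    obtain ⟨s, hs1, hs2⟩ := exists_norming_finset (Y := V) V.subtype fun _ => rfl
    exact ⟨s, hs1, fun v hv => hs2 ⟨v, hv⟩⟩
  have : Module.Free ℂ V := @Module.Free.of_divisionRing ℂ V _ V.addCommGroup _
  let b := Module.finBasis ℂ V
  let f : Fin (Module.finrank ℂ V) → StrongDual ℂ X := fun i => b i
  -- `J z` is the restriction to `s` of the operator `∑ i, f i ⊗ z i`. The adjoint of such an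
  -- operator takes values in `V`, so its values are controlled on `s` alone.
  let J : (Fin (Module.finrank ℂ V) → X) →ₗ[ℂ] (s → X) :=
    LinearMap.pi fun k => ∑ i, f i k • LinearMap.proj i
  have hJ : ∀ z k, J z k = ∑ i, f i k • z i := fun z k => by simp [J]
  let P : (s → X) →L[ℂ] (ι × s → ℂ) :=
    ContinuousLinearMap.pi fun jk => (g jk.1).comp (ContinuousLinearMap.proj jk.2)
  have hP : ∀ y jk, P y jk = g jk.1 (y jk.2) := fun y jk => rfl
  -- Otherwise a functional separates the target from the convex set, with threshold `u`; the steps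
  -- below bound its value at the target by `u`.
  have main : (fun jk : ι × s => T (g jk.1) jk.2) ∈
      closure (P '' ((LinearMap.range J : Set (s → X)) ∩ Metric.closedBall 0 C)) := by
    by_contra hcon
    have hconv : Convex ℝ (P '' ((LinearMap.range J : Set (s → X)) ∩ Metric.closedBall 0 C)) :=
      Convex.linear_image ((((LinearMap.range J).restrictScalars ℝ).convex).inter
        (convex_closedBall 0 C)) ((P : (s → X) →ₗ[ℂ] (ι × s → ℂ)).restrictScalars ℝ)
    obtain ⟨φ, u, hφu, hu⟩ := RCLike.geometric_hahn_banach_closed_point (𝕜 := ℂ)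
      hconv.closure isClosed_closure hcon
    have hU : ∀ m ∈ LinearMap.range J, ‖m‖ ≤ C → (φ (P m)).re < u := fun m hm hmC =>
      hφu _ (subset_closure ⟨m, ⟨hm, by simpa using hmC⟩, rfl⟩)
    have hu0 : 0 < u := by
      simpa using hU 0 (Submodule.zero_mem _) (by simpa using hC.le)
    have hbound : ∀ m : LinearMap.range J,
        ‖(φ.comp P).comp (LinearMap.range J).subtypeL m‖ ≤ u / C * ‖m‖ := by
      rintro ⟨m, hm⟩
      change ‖φ (P m)‖ ≤ u / C * ‖m‖
      by_cases hm0 : m = 0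
      · simp [hm0]
      have hmp : 0 < ‖m‖ := norm_pos_iff.2 hm0
      have h1 := hU ((((starRingEnd ℂ) (φ (P m)) / ‖φ (P m)‖) * ((C / ‖m‖ : ℝ) : ℂ)) • m)
        (Submodule.smul_mem _ _ hm) (by
          rw [norm_smul, norm_mul, norm_div, RCLike.norm_conj, Complex.norm_real, norm_norm,
            Complex.norm_real, Real.norm_of_nonneg (by positivity), mul_assoc,
            div_mul_cancel₀ _ hmp.ne']
          exact mul_le_of_le_one_left hC.le (div_self_le_one _))
      rw [map_smul, map_smul, smul_eq_mul, mul_right_comm, div_mul_eq_mul_div, Complex.conj_mul',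
        ← Complex.ofReal_pow, ← Complex.ofReal_div, ← Complex.ofReal_mul, Complex.ofReal_re, sq,
        mul_self_div_self, mul_div_assoc', div_lt_iff₀ hmp] at h1
      rw [div_mul_eq_mul_div, le_div_iff₀ hC]
      exact h1.le
    -- Replacing `φ ∘ P` by a norm-preserving extension from the range of `J` makes the components
    -- `h k` have total norm at most `u / C`, which the original components `w k` need not satisfy.
    obtain ⟨H, hH, hHn⟩ := exists_extension_norm_eq (LinearMap.range J)
      ((φ.comp P).comp (LinearMap.range J).subtypeL)
    have hHn' : ‖H‖ ≤ u / C := by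
      rw [hHn]
      exact ContinuousLinearMap.opNorm_le_bound _ (by positivity) hbound
    let h : s → StrongDual ℂ X :=
      fun k => H.comp (ContinuousLinearMap.single ℂ (fun _ : s => X) k)
    let w : s → StrongDual ℂ X :=
      fun k => (φ.comp P).comp (ContinuousLinearMap.single ℂ (fun _ : s => X) k)
    have hzero : ∀ i, ∑ k : s, f i k • (w k - h k) = 0 := by
      intro i
      ext y
      have e1 : J (Pi.single i y) = ∑ k : s, f i k • Pi.single (M := fun _ : s => X) k y := by
        ext k
        rw [hJ, Finset.sum_eq_single i, Finset.sum_apply, Finset.sum_eq_single k]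
        · simp
        · intro k' _ hk
          simp [Pi.single_eq_of_ne hk.symm]
        · simp
        · intro i' _ hi
          simp [Pi.single_eq_of_ne hi]
        · simp
      have e2 : φ.comp P (J (Pi.single i y)) - H (J (Pi.single i y)) = 0 := by
        rw [sub_eq_zero]
        exact (hH ⟨_, _, rfl⟩).symm
      rw [e1, map_sum, map_sum, ← Finset.sum_sub_distrib] at e2
      simp only [map_smul, ← smul_sub] at e2
      rw [sum_apply]
      exact e2
    -- Expanding `T r` in the basis `f i` turns this trace-like sum into coordinates of `T` applied
    -- to the relations `hzero`; thus `w` may be exchanged for `h`.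
    have hzero' : ∑ k : s, T (w k - h k) k = 0 := by
      have e1 : ∀ r, T r = ∑ i, b.coord i ⟨T r, hTV r⟩ • f i := fun r => by
        have := congrArg Subtype.val (b.sum_repr ⟨T r, hTV r⟩)
        rw [AddSubmonoidClass.coe_finsetSum] at this
        exact this.symm
      let T' : StrongDual ℂ X →ₗ[ℂ] V := (T : StrongDual ℂ X →ₗ[ℂ] StrongDual ℂ X).rangeRestrict
      have e2 : ∀ r (k : s), T r k = ∑ i, f i k • b.coord i (T' r) := fun r k => by
        conv_lhs => rw [e1 r]
        rw [sum_apply]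
        refine Finset.sum_congr rfl fun i _ => ?_
        exact mul_comm _ _
      simp only [e2]
      rw [Finset.sum_comm]
      refine Finset.sum_eq_zero fun i _ => ?_
      have := congrArg (fun r => b.coord i (T' r)) (hzero i)
      simpa only [map_sum, map_smul, map_zero] using this
    have hφt : φ (fun jk : ι × s => T (g jk.1) jk.2) = ∑ k : s, T (w k) k := by
      have e1 : ∀ v : ι × s → ℂ, φ v = ∑ jk, v jk • φ (fun j => if jk = j then 1 else 0) :=
        fun v => LinearMap.pi_apply_eq_sum_univ (φ : (ι × s → ℂ) →ₗ[ℂ] ℂ) v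
      have e2 : ∀ k, w k = ∑ j, φ (fun j' => if (j, k) = j' then 1 else 0) • g j := by
        intro k
        ext y
        change φ (P (Pi.single k y)) = _
        rw [e1, Fintype.sum_prod_type, sum_apply]
        refine Finset.sum_congr rfl fun j _ => ?_
        rw [Finset.sum_eq_single k]
        · rw [hP, Pi.single_eq_same]
          exact mul_comm _ _
        · intro k' _ hk
          rw [hP, Pi.single_eq_of_ne hk, map_zero, zero_smul]
        · simp
      rw [e1, Fintype.sum_prod_type_right]
      refine Finset.sum_congr rfl fun k _ => ?_
      rw [e2 k, map_sum, sum_apply]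
      refine Finset.sum_congr rfl fun j _ => ?_
      rw [map_smul]
      exact mul_comm _ _
    have hle : ‖∑ k : s, T (w k) k‖ ≤ u := by
      have e1 : ∑ k : s, T (w k) k = ∑ k : s, T (h k) k := by
        rw [← sub_eq_zero, ← Finset.sum_sub_distrib, ← hzero']
        simp only [map_sub, sub_apply]
      rw [e1]
      calc ‖∑ k : s, T (h k) k‖ ≤ ∑ k : s, ‖T (h k) k‖ := norm_sum_le _ _
        _ ≤ ∑ k : s, C * ‖h k‖ := by
          refine Finset.sum_le_sum fun k _ => ?_
          refine ((T (h k)).le_opNorm _).trans ?_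
          refine (mul_le_of_le_one_right (norm_nonneg _) (hs1 k k.2)).trans ?_
          exact T.le_of_opNorm_le hTC _
        _ = C * ∑ k : s, ‖h k‖ := by rw [Finset.mul_sum]
        _ ≤ C * (u / C) := by
          gcongr
          exact (sum_norm_comp_single_le H).trans hHn'
        _ = u := mul_div_cancel₀ _ hC.ne'
    have := (Complex.re_le_norm _).trans hle
    rw [← hφt] at this
    exact absurd hu this.not_gt
  obtain ⟨_, ⟨_, ⟨⟨z, rfl⟩, hz⟩, rfl⟩, hdist⟩ := Metric.mem_closure_iff.1 main (ε / 2) (by positivity)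
  have hz' : ‖J z‖ ≤ C := by simpa using hz
  let E : finiteRankOperators X := ∑ i, rankOne (f i) (z i)
  have hE : ∀ y, (E : X →L[ℂ] X) y = ∑ i, f i y • z i := fun y => by
    simp only [E, AddSubmonoidClass.coe_finsetSum, sum_apply]
    rfl
  have hEJ : ∀ k : s, (E : X →L[ℂ] X) k = J z k := fun k => by rw [hE, hJ]
  have hEV : ∀ r : StrongDual ℂ X, r.comp (E : X →L[ℂ] X) ∈ V := by
    intro r
    have : r.comp (E : X →L[ℂ] X) = ∑ i, r (z i) • f i := by
      ext y
      rw [ContinuousLinearMap.comp_apply, hE, map_sum, sum_apply]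
      refine Finset.sum_congr rfl fun i _ => ?_
      rw [map_smul]
      exact mul_comm _ _
    rw [this]
    exact Submodule.sum_mem _ fun i _ => Submodule.smul_mem _ _ (b i).2
  refine ⟨E, ?_, fun j => ?_⟩
  · refine ContinuousLinearMap.opNorm_le_bound _ (by positivity) fun y => ?_
    refine NormedSpace.norm_le_dual_bound ℂ _ (by positivity) fun r => ?_
    have h1 : ‖r.comp (E : X →L[ℂ] X)‖ ≤ 2 * (‖r‖ * C) := by
      refine hs2 _ (hEV r) _ (by positivity) fun k hk => ?_
      refine (r.le_opNorm _).trans ?_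
      gcongr
      rw [show ‖((E : X →L[ℂ] X) : X →ₗ[ℂ] X) k‖ = _ from congrArg norm (hEJ ⟨k, hk⟩)]
      exact (norm_le_pi_norm (J z) _).trans hz'
    calc ‖r ((E : X →L[ℂ] X) y)‖ ≤ ‖r.comp (E : X →L[ℂ] X)‖ * ‖y‖ :=
          (r.comp (E : X →L[ℂ] X)).le_opNorm y
      _ ≤ 2 * (‖r‖ * C) * ‖y‖ := by gcongr
      _ = 2 * C * ‖y‖ * ‖r‖ := by ring
  · have h1 : ‖(g j).comp (E : X →L[ℂ] X) - T (g j)‖ ≤ 2 * (ε / 2) := by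
      refine hs2 _ (Submodule.sub_mem _ (hEV _) (hTV _)) _ (by positivity) fun k hk => ?_
      have h2 := ((dist_pi_lt_iff (by positivity)).1 hdist (j, ⟨k, hk⟩)).le
      rw [dist_comm, dist_eq_norm, hP] at h2
      simpa only [sub_apply, ContinuousLinearMap.comp_apply,
        hEJ ⟨k, hk⟩] using h2
    linarith

/-- If `X*` has the bounded approximation property, there is a bounded net of finite rank operators
on `X` whose adjoints converge strongly to the identity. -/
theorem exists_finiteRank_net (hX : BoundedApproximationProperty (StrongDual ℂ X)) :
    ∃ (M : ℝ) (E : ℕ × Finset (StrongDual ℂ X) → finiteRankOperators X),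
      (∀ i, ‖(E i : X →L[ℂ] X)‖ ≤ M) ∧
        ∀ f : StrongDual ℂ X,
          Tendsto (fun i => f.comp (E i : X →L[ℂ] X)) atTop (nhds f) := by
  classical
  obtain ⟨C, hC⟩ := hX
  -- One error `1/(n+1)` comes from `T` and one from replacing `T` by an adjoint. The bound `|C| +
  -- 1` secures a positive constant.
  have key : ∀ i : ℕ × Finset (StrongDual ℂ X), ∃ E : finiteRankOperators X,
      ‖(E : X →L[ℂ] X)‖ ≤ 2 * (|C| + 1) ∧
        ∀ f ∈ i.2, ‖f.comp (E : X →L[ℂ] X) - f‖ ≤ 2 * (1 / ((i.1 : ℝ) + 1)) := by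
    rintro ⟨n, G⟩
    have hn : 0 < 1 / ((n : ℝ) + 1) := by positivity
    obtain ⟨T, hT, hTC, hTG⟩ := hC G G.finite_toSet.isCompact _ hn
    obtain ⟨E, hE, hEG⟩ := exists_finiteRank_comp_near hT (C := |C| + 1) (by positivity)
      (hTC.trans ((le_abs_self C).trans (le_add_of_nonneg_right zero_le_one)))
      (fun f : G => (f : StrongDual ℂ X)) hn
    refine ⟨E, hE, fun f hf => ?_⟩
    have h1 := hEG ⟨f, hf⟩
    have h2 := hTG f hf
    calc ‖f.comp (E : X →L[ℂ] X) - f‖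
        = ‖(f.comp (E : X →L[ℂ] X) - T f) + (T f - f)‖ := by rw [sub_add_sub_cancel]
      _ ≤ _ := norm_add_le _ _
      _ ≤ _ := by linarith
  choose E hE hE' using key
  refine ⟨_, E, hE, fun f => ?_⟩
  rw [tendsto_iff_norm_sub_tendsto_zero]
  have h1 : Tendsto (fun i : ℕ × Finset (StrongDual ℂ X) => (2 : ℝ) * (1 / ((i.1 : ℝ) + 1))) atTop
      (nhds 0) := by
    have h2 : Tendsto (fun i : ℕ × Finset (StrongDual ℂ X) => i.1) atTop atTop := by
      rw [← prod_atTop_atTop_eq]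
      exact tendsto_fst
    simpa using ((tendsto_one_div_add_atTop_nhds_zero_nat (𝕜 := ℝ)).comp h2).const_mul 2
  refine squeeze_zero' (Eventually.of_forall fun _ => norm_nonneg _) ?_ h1
  filter_upwards [eventually_ge_atTop ((0, {f}) : ℕ × Finset (StrongDual ℂ X))] with i hi
  exact hE' i f (hi.2 (Finset.mem_singleton_self f))

end Approximation

/-! ### Constructing the invertible centralizer -/

section Abstract

/-- Pointwise convergence to `0` of a uniformly bounded family of linear maps is a closed
condition. -/
theorem isClosed_setOf_tendsto_zero {ι E F : Type*} [SeminormedAddCommGroup E] [Module ℂ E]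
    [SeminormedAddCommGroup F] [Module ℂ F] {l : Filter ι} {T : ι → E →ₗ[ℂ] F} {N : ℝ}
    (hT : ∀ i x, ‖T i x‖ ≤ N * ‖x‖) : IsClosed {x | Tendsto (fun i => T i x) l (nhds 0)} := by
  refine isClosed_of_closure_subset fun x hx => ?_
  rw [Set.mem_ofPred_eq, Metric.tendsto_nhds]
  intro ε hε
  obtain ⟨y, hy, hxy⟩ := Metric.mem_closure_iff.1 hx (ε / (2 * (|N| + 1))) (by positivity)
  filter_upwards [Metric.tendsto_nhds.1 hy (ε / 2) (by positivity)] with i hi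
  rw [dist_zero_right] at hi ⊢
  have h1 : ‖T i (x - y)‖ ≤ ε / 2 := by
    refine (hT i _).trans ?_
    rw [dist_eq_norm, lt_div_iff₀ (by positivity)] at hxy
    have h2 : N * ‖x - y‖ ≤ (|N| + 1) * ‖x - y‖ := by
      gcongr
      exact (le_abs_self N).trans (le_add_of_nonneg_right zero_le_one)
    linarith
  calc ‖T i x‖ = ‖T i (x - y) + T i y‖ := by rw [← map_add, sub_add_cancel]
    _ ≤ ‖T i (x - y)‖ + ‖T i y‖ := norm_add_le _ _
    _ < ε := by linarith

/-- A continuous linear map with approximate preimages of controlled norm is surjective. -/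
theorem surjective_of_exists_approx_preimage {E F : Type*} [NormedAddCommGroup E] [NormedSpace ℂ E]
    [CompleteSpace E] [NormedAddCommGroup F] [NormedSpace ℂ F] (L : E →L[ℂ] F) {K : ℝ}
    (h : ∀ x, ∃ v, ‖v‖ ≤ K * ‖x‖ ∧ ‖x - L v‖ ≤ 2⁻¹ * ‖x‖) : Function.Surjective L := by
  intro x
  choose v hv hv' using h
  -- Successive residuals, halved at each step; their approximate preimages sum to an exact one.
  let r : ℕ → F := fun n => (fun y => y - L (v y))^[n] x
  have hr : ∀ n, r (n + 1) = r n - L (v (r n)) := fun n => Function.iterate_succ_apply' _ _ _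
  have hrn : ∀ n, ‖r n‖ ≤ (2⁻¹ : ℝ) ^ n * ‖x‖ := by
    intro n
    induction n with
    | zero => simp [r]
    | succ n ih =>
      rw [hr, pow_succ', mul_assoc]
      exact (hv' _).trans (by gcongr)
  have hgeo : Summable fun n : ℕ => |K| * ((2⁻¹ : ℝ) ^ n * ‖x‖) :=
    ((summable_geometric_of_lt_one (by norm_num) (by norm_num)).mul_right _).mul_left _
  have hsum : Summable fun n => v (r n) := by
    refine Summable.of_norm_bounded hgeo fun n => (hv _).trans ?_
    gcongr
    · exact le_abs_self K
    · exact hrn n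
  refine ⟨∑' n, v (r n), ?_⟩
  have h1 : HasSum (fun n => L (v (r n))) (L (∑' n, v (r n))) := hsum.hasSum.mapL L
  have h2 : ∀ n, ∑ i ∈ Finset.range n, L (v (r i)) = x - r n := by
    intro n
    induction n with
    | zero => simp [r]
    | succ n ih => rw [Finset.sum_range_succ, ih, hr]; abel
  have h3 : Tendsto r atTop (nhds 0) := by
    refine squeeze_zero_norm hrn ?_
    simpa using (tendsto_pow_atTop_nhds_zero_of_lt_one (r := (2⁻¹ : ℝ)) (by norm_num)
      (by norm_num)).mul_const ‖x‖
  refine tendsto_nhds_unique h1.tendsto_sum_nat ?_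
  simp only [h2]
  simpa using h3.const_sub x

variable {A B : Type*} [NonUnitalNormedRing A] [NormedSpace ℂ A] [CompleteSpace A]
  [NonUnitalNormedRing B] [NormedSpace ℂ B] [IsScalarTower ℂ B B] [SMulCommClass ℂ B B]
  [CompleteSpace B]

theorem jordanProduct_self {R : Type*} [NonUnitalRing R] [Module ℂ R] (a : R) :
    jordanProduct a a = (2 : ℂ) • (a * a) := (two_smul ℂ _).symm

theorem norm_jordanProduct_le {R : Type*} [NonUnitalNormedRing R] (a b : R) :
    ‖jordanProduct a b‖ ≤ 2 * (‖a‖ * ‖b‖) :=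
  calc ‖jordanProduct a b‖ ≤ ‖a * b‖ + ‖b * a‖ := norm_add_le _ _
    _ ≤ ‖a‖ * ‖b‖ + ‖b‖ * ‖a‖ := add_le_add (norm_mul_le _ _) (norm_mul_le _ _)
    _ = 2 * (‖a‖ * ‖b‖) := by ring

/-- If `Φ (S) ∘ Φ (T) = τ (S ∘ T)`, then `Φ` is a weighted Jordan homomorphism, provided that the
domain is spanned by idempotents up to closure and contains a suitable bounded approximate
identity. -/
theorem isWeightedJordanHomomorphism_of_factor (hB : HasBoundedApproximateIdentity B)
    {Φ : A →L[ℂ] B} (hΦ : Function.Surjective Φ) {τ : A →L[ℂ] B}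
    (hτ : ∀ S T, jordanProduct (Φ S) (Φ T) = τ (jordanProduct S T))
    {ι : Type*} {l : Filter ι} [l.NeBot] {E : ι → A} {M : ℝ} (hE : ∀ i, ‖E i‖ ≤ M)
    (hlim : ∀ (β : StrongDual ℂ B) (S : A),
      Tendsto (fun i => β (jordanProduct (Φ S) (Φ (E i)))) l (nhds (2 * β (τ S))))
    (hidem : Dense (Submodule.span ℂ {p : A | p * p = p} : Set A)) :
    IsWeightedJordanHomomorphism (Φ : A →ₗ[ℂ] B) := by
  have hsep : ∀ x y : B, (∀ β : StrongDual ℂ B, β x = β y) → x = y := by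
    intro x y h
    by_contra hxy
    obtain ⟨β, hβ⟩ := SeparatingDual.exists_separating_of_ne (R := ℂ) hxy
    exact hβ (h β)
  have hker : ∀ S, Φ S = 0 → τ S = 0 := by
    intro S hS
    refine hsep _ _ fun β => ?_
    have h1 := hlim β S
    simp only [hS, jordanProduct, zero_mul, mul_zero, add_zero, map_zero] at h1
    have h2 := tendsto_nhds_unique h1 tendsto_const_nhds
    simpa using h2
  obtain ⟨K, hK, hpre⟩ := Φ.exists_preimage_norm_le hΦ
  choose g hg hgn using hpre
  have hker' : ∀ S T, Φ S = Φ T → τ S = τ T := fun S T h => by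
    rw [← sub_eq_zero, ← map_sub]
    exact hker _ (by rw [map_sub, h, sub_self])
  let L : B →L[ℂ] B := LinearMap.mkContinuous
    { toFun := fun x => τ (g x)
      map_add' := fun x y => by
        rw [← map_add]
        exact hker' _ _ (by rw [map_add, hg, hg, hg])
      map_smul' := fun c x => by
        rw [RingHom.id_apply, ← map_smul]
        exact hker' _ _ (by rw [map_smul, hg, hg]) } (‖τ‖ * K) fun x =>
    (τ.le_opNorm _).trans (by
      rw [mul_assoc]
      exact mul_le_mul_of_nonneg_left (hgn x) (norm_nonneg _))
  have hL : ∀ S, L (Φ S) = τ S := fun S => hker' _ _ (hg _)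
  have hJL : ∀ x y, jordanProduct x y = L (Φ (jordanProduct (g x) (g y))) := fun x y => by
    rw [hL, ← hτ, hg, hg]
  have hlimL : ∀ (β : StrongDual ℂ B) (x : B),
      Tendsto (fun i => β (jordanProduct x (Φ (E i)))) l (nhds (2 * β (L x))) := fun β x => by
    have := hlim β (g x)
    rw [hg] at this
    exact this
  have hw : ∀ i, ‖Φ (E i)‖ ≤ ‖Φ‖ * M := fun i => Φ.le_opNorm_of_le (hE i)
  -- the commutators with `Φ (E i)` tend weakly to zero
  let D : StrongDual ℂ B → ι → B →ₗ[ℂ] ℂ := fun β i =>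
    (β : B →ₗ[ℂ] ℂ) ∘ₗ (LinearMap.mulLeft ℂ (Φ (E i)) - LinearMap.mulRight ℂ (Φ (E i)))
  have hD : ∀ β i z, D β i z = β (Φ (E i) * z - z * Φ (E i)) := fun β i z => rfl
  have hDn : ∀ β i z, ‖D β i z‖ ≤ (‖β‖ * (2 * (‖Φ‖ * M))) * ‖z‖ := by
    intro β i z
    rw [hD, mul_assoc]
    refine β.le_opNorm_of_le ?_
    calc ‖Φ (E i) * z - z * Φ (E i)‖ ≤ ‖Φ (E i)‖ * ‖z‖ + ‖z‖ * ‖Φ (E i)‖ :=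
          (norm_sub_le _ _).trans (add_le_add (norm_mul_le _ _) (norm_mul_le _ _))
      _ = 2 * ‖Φ (E i)‖ * ‖z‖ := by ring
      _ ≤ 2 * (‖Φ‖ * M) * ‖z‖ := by
        gcongr
        exact hw i
  have hcomm : ∀ β z, Tendsto (fun i => D β i z) l (nhds 0) := by
    intro β
    have hclosed := isClosed_setOf_tendsto_zero (l := l) (hDn β)
    let Z : Submodule ℂ B :=
      { carrier := {z | Tendsto (fun i => D β i z) l (nhds 0)}
        add_mem' := fun {x y} hx hy => by
          have := Tendsto.add hx hy
          simpa only [Set.mem_ofPred_eq, map_add, add_zero] using this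
        zero_mem' := by simp
        smul_mem' := fun c x hx => by
          have := Tendsto.const_smul hx c
          simpa only [Set.mem_ofPred_eq, map_smul, smul_zero] using this }
    have hZ : IsClosed (Z : Set B) := hclosed
    have h1 : Submodule.span ℂ {p : A | p * p = p} ≤
        Z.comap ((L.comp Φ : A →L[ℂ] B) : A →ₗ[ℂ] B) := by
      rw [Submodule.span_le]
      intro e he
      have hLp : L (Φ e) = Φ e * Φ e := by
        have h2 := hτ e e
        rw [jordanProduct_self, jordanProduct_self, he, map_smul, ← hL] at h2
        exact (smul_right_injective B (two_ne_zero (α := ℂ)) h2).symm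
      change Tendsto (fun i => D β i (L (Φ e))) l (nhds 0)
      -- With `a = Φ e` and `w = Φ (E i)`, one has `[w, a²] = [w ∘ a, a]`. Here `w ∘ a` tends weakly
      -- to `2 L a = 2 a²`, which commutes with `a`.
      let γ : StrongDual ℂ B := β.comp
        ((ContinuousLinearMap.mul ℂ B).flip (Φ e) - ContinuousLinearMap.mul ℂ B (Φ e))
      have hγ : ∀ y, γ y = β (y * Φ e - Φ e * y) := fun y => rfl
      have h3 := hlimL γ (Φ e)
      rw [hLp, hγ, mul_assoc, sub_self, map_zero, mul_zero] at h3
      refine h3.congr fun i => ?_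
      rw [hγ, hD, hLp]
      congr 1
      simp only [jordanProduct, mul_add, add_mul, mul_assoc]
      abel
    have h2 : ∀ S, L (Φ S) ∈ Z := by
      have h3 : IsClosed {S | L (Φ S) ∈ Z} := hZ.preimage (L.comp Φ).continuous
      intro S
      exact h3.closure_subset_iff.2 (fun S hS => h1 hS) (hidem S)
    obtain ⟨F, hF, -⟩ := hB
    have : F.NeBot := hF.neBot
    intro z
    -- Jordan products lie in the range of `L`, hence in the closed subspace `Z`; the approximate
    -- identity recovers `2z` from them.
    have h3 : Tendsto (fun f => jordanProduct z f) F (nhds (z + z)) :=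
      (hF.tendsto_mul_left z).add (hF.tendsto_mul_right z)
    have h4 : z + z ∈ Z := hZ.mem_of_tendsto h3 (Eventually.of_forall fun f => by
      rw [hJL]
      exact h2 _)
    have h5 := Z.smul_mem (2⁻¹ : ℂ) h4
    rwa [← two_smul ℂ, smul_smul, inv_mul_cancel₀ two_ne_zero, one_smul] at h5
  have hleft : ∀ (β : StrongDual ℂ B) z, Tendsto (fun i => β (Φ (E i) * z)) l (nhds (β (L z))) := by
    intro β z
    have h1 := ((hlimL β z).add (hcomm β z)).const_mul (2⁻¹ : ℂ)
    rw [add_zero, inv_mul_cancel_left₀ two_ne_zero] at h1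
    refine h1.congr fun i => ?_
    rw [hD, ← map_add, jordanProduct, show z * Φ (E i) + Φ (E i) * z + (Φ (E i) * z - z * Φ (E i)) =
      (2 : ℂ) • (Φ (E i) * z) by rw [two_smul]; abel, map_smul, smul_eq_mul,
      inv_mul_cancel_left₀ two_ne_zero]
  have hright : ∀ (β : StrongDual ℂ B) z, Tendsto (fun i => β (z * Φ (E i))) l (nhds (β (L z))) := by
    intro β z
    have h1 := (hleft β z).sub (hcomm β z)
    rw [sub_zero] at h1
    refine h1.congr fun i => ?_
    rw [hD, ← map_sub, sub_sub_cancel]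
  have hcent : IsCentralizer (L : B →ₗ[ℂ] B) := by
    intro a b
    constructor
    · refine hsep _ _ fun β => ?_
      have h1 := hleft (β.comp ((ContinuousLinearMap.mul ℂ B).flip b)) a
      refine tendsto_nhds_unique (hleft β (a * b)) (h1.congr fun i => ?_)
      exact congrArg β (mul_assoc _ _ _)
    · refine hsep _ _ fun β => ?_
      have h1 := hright (β.comp (ContinuousLinearMap.mul ℂ B a)) b
      refine tendsto_nhds_unique (hright β (a * b)) (h1.congr fun i => ?_)
      exact congrArg β (mul_assoc _ _ _).symm
  have hsurj : Function.Surjective L := by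
    obtain ⟨F, hF, M', hM'⟩ := hB
    have : F.NeBot := hF.neBot
    refine surjective_of_exists_approx_preimage L (K := ‖Φ‖ * (K * (K * M'))) fun x => ?_
    by_cases hx : x = 0
    · exact ⟨0, by simp [hx], by simp [hx]⟩
    have h3 : Tendsto (fun f => (2⁻¹ : ℂ) • jordanProduct x f) F (nhds x) := by
      have := ((hF.tendsto_mul_left x).add (hF.tendsto_mul_right x)).const_smul (2⁻¹ : ℂ)
      rwa [← two_smul ℂ x, smul_smul, inv_mul_cancel₀ two_ne_zero, one_smul] at this
    have hxn : 0 < 2⁻¹ * ‖x‖ := by have := norm_pos_iff.2 hx; positivity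
    obtain ⟨f, hf, hfM⟩ := ((Metric.tendsto_nhds.1 h3 _ hxn).and hM').exists
    refine ⟨(2⁻¹ : ℂ) • Φ (jordanProduct (g x) (g f)), ?_, ?_⟩
    · rw [norm_smul, norm_inv, Complex.norm_ofNat]
      have h4 : ‖jordanProduct (g x) (g f)‖ ≤ 2 * ((K * ‖x‖) * (K * M')) := by
        refine (norm_jordanProduct_le _ _).trans ?_
        have := (hgn f).trans (mul_le_mul_of_nonneg_left hfM hK.le)
        have := hgn x
        gcongr
      have h5 := Φ.le_opNorm_of_le h4
      calc 2⁻¹ * ‖Φ (jordanProduct (g x) (g f))‖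
          ≤ 2⁻¹ * (‖Φ‖ * (2 * ((K * ‖x‖) * (K * M')))) := by gcongr
        _ = ‖Φ‖ * (K * (K * M')) * ‖x‖ := by ring
    · rw [map_smul, ← hJL, ← dist_eq_norm, dist_comm]
      exact hf.le
  have hinj : Function.Injective L := by
    rw [injective_iff_map_eq_zero]
    intro x hx
    obtain ⟨F, hF, -⟩ := hB
    have : F.NeBot := hF.neBot
    -- For a surjective centralizer, `x L(z) = L(x) z` makes any kernel element annihilate `B`.
    have h1 : ∀ y, x * y = 0 := by
      intro y
      obtain ⟨z, rfl⟩ := hsurj y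
      have h2 := hcent x z
      have h3 : x * L z = L x * z := h2.2.symm.trans h2.1
      rw [h3, hx, zero_mul]
    have h2 := hF.tendsto_mul_left x
    simp only [h1] at h2
    exact tendsto_nhds_unique h2 tendsto_const_nhds
  let e : B ≃ₗ[ℂ] B := LinearEquiv.ofBijective (L : B →ₗ[ℂ] B) ⟨hinj, hsurj⟩
  have he : ∀ x, L (e.symm x) = x := e.apply_symm_apply
  refine ⟨L, hcent, ⟨hinj, hsurj⟩, (e.symm : B →ₗ[ℂ] B) ∘ₗ (Φ : A →ₗ[ℂ] B), fun a b => ?_, ?_⟩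
  -- After applying `L` twice, both sides equal `Φ a ∘ Φ b = τ (a ∘ b)`.
  · apply hinj
    apply hinj
    have h1 : ∀ x y, L (L (x * y)) = L x * L y := fun x y => by
      rw [show L (x * y) = L x * y from (hcent x y).1]
      exact (hcent _ _).2
    have h2 : ∀ x, L (((e.symm : B →ₗ[ℂ] B) ∘ₗ (Φ : A →ₗ[ℂ] B)) x) = Φ x := fun x => he _
    rw [h2, jordanProduct.eq_def (((e.symm : B →ₗ[ℂ] B) ∘ₗ (Φ : A →ₗ[ℂ] B)) a), map_add, map_add,
      h1, h1, h2, h2, hL, ← hτ, jordanProduct]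
  · ext x
    exact (he _).symm

end Abstract

/-! ### Weak limits, boundedness of `τ`, and passage to the closure -/

section Approximable

variable {X : Type*} [NormedAddCommGroup X] [NormedSpace ℂ X]

instance instNormedSpaceOperatorSubalgebra (S : NonUnitalSubalgebra ℂ (X →L[ℂ] X)) :
    NormedSpace ℂ S where
  norm_smul_le c T := norm_smul_le c (T : X →L[ℂ] X)

/-- The inclusion of the finite rank operators into the approximable operators. -/
def finiteRankInclusion (X : Type*) [NormedAddCommGroup X] [NormedSpace ℂ X] :
    finiteRankOperators X →ₗᵢ[ℂ] approximableOperators X where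
  toFun S := ⟨S, (finiteRankOperators X).le_topologicalClosure S.2⟩
  map_add' _ _ := rfl
  map_smul' _ _ := rfl
  norm_map' _ := rfl

theorem denseRange_finiteRankInclusion : DenseRange (finiteRankInclusion X) := by
  rintro ⟨T, hT⟩
  rw [Metric.mem_closure_iff]
  intro ε hε
  obtain ⟨S, hS, hTS⟩ := Metric.mem_closure_iff.1
    (show T ∈ closure (finiteRankOperators X : Set (X →L[ℂ] X)) from hT) ε hε
  exact ⟨_, ⟨⟨S, hS⟩, rfl⟩, hTS⟩

theorem continuous_rankOne_left (x : X) :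
    Continuous fun f : StrongDual ℂ X => rankOne f x :=
  Continuous.subtype_mk ((ContinuousLinearMap.smulRightL ℂ X X).flip x).continuous _

theorem continuous_rankOne_right (f : StrongDual ℂ X) : Continuous fun x : X => rankOne f x :=
  Continuous.subtype_mk ((ContinuousLinearMap.smulRightL ℂ X X) f).continuous _

variable {B : Type*} [NonUnitalNormedRing B] [NormedSpace ℂ B]

/-- If `τ (S ∘ T)` is separately continuous in `S` and `T`, then `τ (S ∘ E i)` converges weakly to
`2 τ (S)` along any net whose adjoints converge strongly to the identity. -/
theorem tendsto_apply_jordanProduct {τ : finiteRankOperators X →ₗ[ℂ] B}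
    (hτ : ∀ S, Continuous fun T => τ (jordanProduct S T)) {ι : Type*} {l : Filter ι}
    {E : ι → finiteRankOperators X}
    (hE : ∀ f : StrongDual ℂ X, Tendsto (fun i => f.comp (E i : X →L[ℂ] X)) l (nhds f))
    (β : StrongDual ℂ B) (S : finiteRankOperators X) :
    Tendsto (fun i => β (τ (jordanProduct S (E i)))) l (nhds (2 * β (τ S))) := by
  induction mem_span_rankOne S using Submodule.span_induction with
  | zero =>
    simp only [jordanProduct, zero_mul, mul_zero, add_zero, map_zero]
    exact tendsto_const_nhds
  | add S T _ _ hS hT =>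
    rw [map_add, map_add, mul_add]
    refine (hS.add hT).congr fun i => ?_
    rw [← map_add, ← map_add]
    congr 2
    simp only [jordanProduct, add_mul, mul_add]
    abel
  | smul c S _ hS =>
    rw [map_smul, map_smul, smul_eq_mul, mul_left_comm]
    refine (hS.const_mul c).congr fun i => ?_
    rw [← smul_eq_mul, ← map_smul, ← map_smul]
    congr 2
    simp only [jordanProduct, smul_add, smul_mul_assoc, mul_smul_comm]
  | mem S hS =>
    obtain ⟨f, x, rfl⟩ := hS
    have hleft : Continuous fun h : StrongDual ℂ X => τ (rankOne h x) := by
      by_cases hx : x = 0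
      · have h0 : ∀ h : StrongDual ℂ X, rankOne h x = 0 := fun h => by ext; simp [hx]
        simp only [h0]
        exact continuous_const
      obtain ⟨k, hk⟩ := SeparatingDual.exists_eq_one (R := ℂ) hx
      -- When `k x = 1`, `(k ⊗ x) ∘ (h ⊗ x) = h ⊗ x + h(x) (k ⊗ x)`, so separate continuity of `τ (S
      -- ∘ T)` passes to `τ` on this slice.
      have h1 : ∀ h : StrongDual ℂ X, τ (rankOne h x) =
          τ (jordanProduct (rankOne k x) (rankOne h x)) - h x • τ (rankOne k x) := by
        intro h
        rw [jordanProduct, rankOne_mul_rankOne, rankOne_mul_rankOne, hk, one_smul, map_add,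
          map_smul, add_sub_cancel_right]
      rw [funext h1]
      exact ((hτ _).comp (continuous_rankOne_left x)).sub
        ((ContinuousLinearMap.apply ℂ ℂ x).continuous.smul continuous_const)
    have hright : Continuous fun y : X => τ (rankOne f y) := by
      by_cases hf : f = 0
      · have h0 : ∀ y : X, rankOne f y = 0 := fun y => by ext; simp [hf]
        simp only [h0]
        exact continuous_const
      obtain ⟨z, hz⟩ : ∃ z, f z ≠ 0 := DFunLike.ne_iff.1 hf
      have h1 : ∀ y : X, τ (rankOne f y) =
          (f z)⁻¹ • (τ (jordanProduct (rankOne f z) (rankOne f y)) - f y • τ (rankOne f z)) := by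
        intro y
        rw [jordanProduct, rankOne_mul_rankOne, rankOne_mul_rankOne, map_add, map_smul, map_smul,
          add_sub_cancel_left, smul_smul, inv_mul_cancel₀ hz, one_smul]
      rw [funext h1]
      exact (((hτ _).comp (continuous_rankOne_right f)).sub
        (f.continuous.smul continuous_const)).const_smul _
    -- The term `E i (f ⊗ x) = f ⊗ E i x` is only controlled weakly: its image under `β ∘ τ` is `h
    -- (E i x)`, and `h ∘ E i` tends to `h`.
    let h : StrongDual ℂ X :=
      { toFun := fun y => β (τ (rankOne f y))
        map_add' := fun y z => by rw [rankOne_add_right, map_add, map_add]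
        map_smul' := fun c y => by rw [rankOne_smul_right, map_smul, map_smul]; rfl
        cont := β.continuous.comp hright }
    have t1 : Tendsto (fun i => β (τ (rankOne f x * E i))) l (nhds (β (τ (rankOne f x)))) := by
      simp only [rankOne_mul]
      exact ((β.continuous.comp hleft).tendsto f).comp (hE f)
    have t2 : Tendsto (fun i => β (τ (E i * rankOne f x))) l (nhds (β (τ (rankOne f x)))) := by
      simp only [mul_rankOne]
      exact ((ContinuousLinearMap.apply ℂ ℂ x).continuous.tendsto h).comp (hE h)
    rw [two_mul]
    refine (t1.add t2).congr fun i => ?_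
    rw [← map_add, ← map_add, jordanProduct]

theorem isWeightedJordanHomomorphism_of_denseRange_finiteRank {A : Type*} [NonUnitalNormedRing A]
    [NormedSpace ℂ A] [CompleteSpace A] (j : finiteRankOperators X →ₗᵢ[ℂ] A)
    (hj : ∀ S T, j (S * T) = j S * j T) (hjd : DenseRange j)
    (hX : BoundedApproximationProperty (StrongDual ℂ X))
    [IsScalarTower ℂ B B] [SMulCommClass ℂ B B] [CompleteSpace B]
    (hB : HasBoundedApproximateIdentity B) (Φ : A →L[ℂ] B) (hΦ : Function.Surjective Φ)
    (hzero : ∀ S T : A, S * T = 0 → T * S = 0 → jordanProduct (Φ S) (Φ T) = 0) :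
    IsWeightedJordanHomomorphism (Φ : A →ₗ[ℂ] B) := by
  have hjJ : ∀ S T, j (jordanProduct S T) = jordanProduct (j S) (j T) := fun S T => by
    rw [jordanProduct, map_add, hj, hj, jordanProduct]
  have hidem : Dense (Submodule.span ℂ {p : A | p * p = p} : Set A) := by
    refine hjd.mono ?_
    rintro _ ⟨S, rfl⟩
    have h : Submodule.span ℂ {p : finiteRankOperators X | p * p = p} ≤
        (Submodule.span ℂ {p : A | p * p = p}).comap j.toLinearMap := by
      rw [Submodule.span_le]
      intro p hp
      refine Submodule.subset_span ?_
      change j p * j p = j p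
      rw [← hj, hp]
    exact h (span_idempotents_finiteRankOperators trivial)
  classical
  let φ : finiteRankOperators X →ₗ[ℂ] finiteRankOperators X →ₗ[ℂ] B :=
    LinearMap.mk₂ ℂ (fun S T => jordanProduct (Φ (j S)) (Φ (j T)))
      (fun S S' T => by simp only [jordanProduct, map_add, add_mul, mul_add]; abel)
      (fun c S T => by
        simp only [jordanProduct, map_smul, smul_add, smul_mul_assoc, mul_smul_comm])
      (fun S T T' => by simp only [jordanProduct, map_add, add_mul, mul_add]; abel)
      (fun c S T => by
        simp only [jordanProduct, map_smul, smul_add, smul_mul_assoc, mul_smul_comm])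
  obtain ⟨τ, hτ⟩ := exists_factor_jordanProduct φ (fun S T => add_comm _ _)
    (fun S T h h' => hzero _ _ (by rw [← hj, h]; exact j.toLinearMap.map_zero)
      (by rw [← hj, h']; exact j.toLinearMap.map_zero)) exists_local_unit
    span_idempotents_finiteRankOperators
  have hτ' : ∀ S T, jordanProduct (Φ (j S)) (Φ (j T)) = τ (jordanProduct S T) := hτ
  obtain ⟨M, E, hEM, hE⟩ := exists_finiteRank_net hX
  have hjE : ∀ i, ‖j (E i)‖ ≤ M := fun i => (j.norm_map _).trans_le (hEM i)
  have hlim := tendsto_apply_jordanProduct (τ := τ) (fun S => by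
    have h1 := Φ.continuous.comp j.continuous
    have h2 : Continuous fun T => jordanProduct (Φ (j S)) (Φ (j T)) :=
      (continuous_const.mul h1).add (h1.mul continuous_const)
    exact h2.congr (hτ' S)) hE
  have hM0 : 0 ≤ M := (norm_nonneg _).trans (hjE (0, ∅))
  -- The weak limit of the bounded net `Φ(S) ∘ Φ(E i)` controls `2 τ S`.
  have hbound : ∀ S, ‖τ S‖ ≤ ‖Φ‖ * (‖Φ‖ * M) * ‖S‖ := by
    intro S
    refine NormedSpace.norm_le_dual_bound ℂ _ (by positivity) fun β => ?_
    have h1 : ‖2 * β (τ S)‖ ≤ ‖β‖ * (2 * ((‖Φ‖ * ‖S‖) * (‖Φ‖ * M))) := by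
      refine le_of_tendsto (hlim β S).norm (Eventually.of_forall fun i => ?_)
      refine β.le_opNorm_of_le ?_
      rw [← hτ']
      refine (norm_jordanProduct_le _ _).trans ?_
      gcongr
      · exact (Φ.le_opNorm (j S)).trans_eq (by rw [j.norm_map])
      · exact Φ.le_opNorm_of_le (hjE i)
    rw [norm_mul, Complex.norm_ofNat] at h1
    linarith
  let τ' : A →L[ℂ] B :=
    (τ.mkContinuous _ hbound).extend j.toContinuousLinearMap
  have hτj : ∀ S, τ' (j S) = τ S := fun S =>
    ContinuousLinearMap.extend_eq (τ.mkContinuous _ hbound)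
      (e := j.toContinuousLinearMap) hjd
      j.isometry.isUniformInducing S
  refine isWeightedJordanHomomorphism_of_factor hB hΦ (τ := τ') (fun S T => ?_)
    (l := atTop) hjE (fun β S => ?_) hidem
  · refine hjd.induction_on₂ (p := fun S T =>
      jordanProduct (Φ S) (Φ T) = τ' (jordanProduct S T)) ?_ (fun S T => ?_) S T
    · unfold jordanProduct
      exact isClosed_eq (by fun_prop) (by fun_prop)
    · rw [← hjJ]
      exact (hτ' S T).trans (hτj _).symm
  -- `D i` measures the deviation from the weak limit. It is bounded uniformly in `i`, so its
  -- convergence to zero extends from `F` to the closure.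
  · let D : ℕ × Finset (StrongDual ℂ X) → A →ₗ[ℂ] ℂ := fun i =>
      (β : B →ₗ[ℂ] ℂ) ∘ₗ ((LinearMap.mulRight ℂ (Φ (j (E i))) + LinearMap.mulLeft ℂ (Φ (j (E i))))
        ∘ₗ (Φ : A →ₗ[ℂ] B) - (2 : ℂ) • (τ' : _ →ₗ[ℂ] B))
    have hD : ∀ i S, D i S = β (jordanProduct (Φ S) (Φ (j (E i)))) - 2 * β (τ' S) := by
      intro i S
      change β (_ - (2 : ℂ) • τ' S) = _
      rw [map_sub, map_smul]
      rfl
    have hDn : ∀ i S, ‖D i S‖ ≤ (‖β‖ * (2 * (‖Φ‖ * (‖Φ‖ * M))) + 2 * (‖β‖ * ‖τ'‖)) * ‖S‖ := by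
      intro i S
      rw [hD, add_mul]
      refine (norm_sub_le _ _).trans (add_le_add ?_ ?_)
      · rw [mul_assoc]
        refine β.le_opNorm_of_le ((norm_jordanProduct_le _ _).trans ?_)
        calc 2 * (‖Φ S‖ * ‖Φ (j (E i))‖) ≤ 2 * ((‖Φ‖ * ‖S‖) * (‖Φ‖ * M)) := by
              gcongr
              · exact Φ.le_opNorm S
              · exact Φ.le_opNorm_of_le (hjE i)
          _ = 2 * (‖Φ‖ * (‖Φ‖ * M)) * ‖S‖ := by ring
      · rw [norm_mul, Complex.norm_ofNat, mul_assoc, mul_assoc]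
        gcongr
        exact β.le_opNorm_of_le (τ'.le_opNorm S)
    have hz : ∀ S, Tendsto (fun i => D i S) atTop (nhds 0) := by
      intro S
      refine (isClosed_setOf_tendsto_zero (l := atTop) hDn).closure_subset_iff.2 ?_
        (hjd S)
      rintro _ ⟨S, rfl⟩
      have h1 := (hlim β S).sub_const (2 * β (τ S))
      rw [sub_self] at h1
      refine h1.congr fun i => ?_
      rw [hD, ← hτ']
      exact congrArg (fun y => _ - 2 * β y) (hτj S).symm
    have h1 := (hz S).add_const (2 * β (τ' S))
    rw [zero_add] at h1
    refine h1.congr fun i => ?_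
    rw [hD, sub_add_cancel]

end Approximable

theorem theorem3p3 {X : Type*} [NormedAddCommGroup X] [NormedSpace ℂ X] [CompleteSpace X]
    (hX : BoundedApproximationProperty (StrongDual ℂ X))
    {B : Type*} [NonUnitalNormedRing B] [NormedSpace ℂ B] [IsScalarTower ℂ B B]
    [SMulCommClass ℂ B B] [CompleteSpace B]
    (hB : HasBoundedApproximateIdentity B)
    (Φ : approximableOperators X →L[ℂ] B) (hΦ : Function.Surjective Φ)
    (hzero : ∀ S T : approximableOperators X, S * T = 0 → T * S = 0 →
      jordanProduct (Φ S) (Φ T) = 0) :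
    IsWeightedJordanHomomorphism (Φ : approximableOperators X →ₗ[ℂ] B) := by
  have : CompleteSpace (approximableOperators X) :=
    (finiteRankOperators X).isClosed_topologicalClosure.completeSpace_coe
  refine isWeightedJordanHomomorphism_of_denseRange_finiteRank (A := approximableOperators X)
    (finiteRankInclusion X) ?_ ?_ hX hB Φ hΦ hzero
  · exact fun _ _ => rfl
  · exact denseRange_finiteRankInclusion
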